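/- **Setting.** Let $\mathcal P=(\mathcal P,d,\mu)$ be a metric space equipped with a complete Borel measure $\mu$ (a measure on a $\sigma$-algebra containing all Borel sets, complete, with a.e. and "measurable" understood with respect to it) such that $0<\mu(B)<\infty$ for every ball $B$. Let $X$ be a quasi-Banach function lattice on $\mathcal P$: there is a functional $\|\cdot\|_X$ assigning a value in $[0,\infty]$ to every measurable $u:\mathcal P\to\overline{\mathbf R}:=[-\infty,\infty]$, and $X=\{u \text{ measurable}:\|u\|_X<\infty\}$ (functions are defined everywhere), such that for some constant $c_X\ge1$ and all measurable functions $u$, $v$, $u_n$: * $\|u\|_X=0$ if and only if $u=0$ a.e.; $\|au\|_X=|a|\,\|u\|_X$ for $a\in\mathbf R$; $\|u+v\|_X\le c_X(\|u\|_X+\|v\|_X)$; * if $|u|\le|v|$ a.e., then $\|u\|_X\le\|v\|_X$; * if $u_n\ge0$ a.e. for $n=1,2,\dots$, then $\bigl\|\sum_{n=1}^\infty u_n\bigr\|_X\le\sum_{n=1}^\infty c_X^n\|u_n\|_X$; * if $\|u_n-u\|_X\to0$, then $\|u_n\|_X\to\|u\|_X$. A Borel function $g:\mathcal P\to[0,\infty]$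 is an *upper gradient* of $u:\mathcal P\to\overline{\mathbf R}$ if $|u(\gamma(0))-u(\gamma(l_\gamma))|\le\int_\gamma g\,ds$ for every nonconstant rectifiable curve $\gamma:[0,l_\gamma]\to\mathcal P$ parametrized by arc length, where $|(\pm\infty)-(\pm\infty)|:=\infty$. The *Newtonian space* is $N^1X=\{u\in X:\|u\|_{N^1X}:=\|u\|_X+\inf_g\|g\|_X<\infty\}$, with the infimum over all upper gradients $g$ of $u$. The *capacity* of a set $E\subset\mathcal P$ is $C_X(E)=\inf\{\|u\|_{N^1X}:u\in N^1X,\ u\ge1\text{ on }E\}$ (with $\inf\varnothing=\infty$), and a property holds *q.e.* if it holds outside a set of zero capacity. The capacity is *$c$-quasiouter*, $c\ge1$, if $\inf\{C_X(G):G\supset E,\ G\text{ open}\}\le c\,C_X(E)$ for every $E\subset\mathcal P$; it is *quasiouter* if it is $c$-quasiouter for some $c\ge 1$ and *outer* if it is $1$-quasiouter; it is *outer for sets of zero capacity* if for every $E$ with $C_X(E)=0$ and every $\varepsilon>0$ there is an open $G\supset E$ with $C_X(G)<\varepsilon$. A function $u:\mathcal P\to\overline{\mathbf R}$ is *weakly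 quasicontinuous* if for every $\varepsilon>0$ there is $E\subset\mathcal P$ with $C_X(E)<\varepsilon$ such that $u|_{\mathcal P\setminus E}$ is real-valued and continuous; it is *quasicontinuous* if $E$ can always be chosen open. **Theorem.** Consider the following properties of $(\mathcal P,X)$: * (A) Every $u\in N^1X$ is quasicontinuous. * (B) $C_X$ is an outer capacity. * (C) $C_X$ is a quasiouter capacity. * (D) Every weakly quasicontinuous $u:\mathcal P\to\overline{\mathbf R}$ is quasicontinuous. * (E) $C_X$ is an outer capacity for sets of zero capacity. * (F) Every $u\in N^1X$ has a quasicontinuous representative $v$, i.e. $v=u$ q.e. * (G) Every $u\in N^1X$ is weakly quasicontinuous. Then for all $\mathcal P$ and $X$ as above, $$(\text{D and G})\iff(\text{E and F})\iff\text{A},$$ $$\text{A}\Rightarrow\text{B}\Rightarrow\text{C}\Rightarrow\text{D}\Rightarrow\text{E}\qquad\text{and}\qquad\text{A}\Rightarrow\text{F}\Rightarrow\text{G}.$$ On the other hand, in general B $\not\Rightarrow$ A, C $\not\Rightarrow$ B, D $\not\Rightarrow$ C, B $\not\Rightarrow$ G, F $\not\Rightarrow$ E and G $\not\Rightarrow$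 F; that is, for each of these six there are $\mathcal P$ and $X$ as above for which the first property holds and the second fails. Moreover, there are $\mathcal P$ and $X$ as above for which all of (A)–(G) fail. -/

import Mathlib

open MeasureTheory Set Filter Topology
open scoped ENNReal NNReal

/-- Every open ball (of positive radius) has positive and finite measure. -/
def BallsPosFinite {P : Type*} [MetricSpace P] [MeasurableSpace P] (μ : Measure P) : Prop :=
  ∀ (x : P) (r : ℝ), 0 < r → 0 < μ (Metric.ball x r) ∧ μ (Metric.ball x r) < ∞

/-- A quasi-Banach function lattice over the completion of `μ`, with continuous quasinorm.
Functions are extended real-valued and defined everywhere.  "Measurable" means measurable for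
the completion of `μ`, i.e. `AEMeasurable _ μ`; the values of `nrm` at functions which are not
measurable in this sense play no role.  The space itself is `{u | X.Mem u}` below. -/
structure QuasiBanachFunctionLattice {P : Type*} [MeasurableSpace P] (μ : Measure P) where
  /-- the quasinorm `‖u‖_X ∈ [0,∞]` -/
  nrm : (P → EReal) → ℝ≥0∞
  /-- the modulus of concavity -/
  modulus : ℝ≥0
  one_le_modulus : 1 ≤ modulus
  nrm_eq_zero_iff : ∀ u : P → EReal, AEMeasurable u μ → (nrm u = 0 ↔ u =ᵐ[μ] 0)
  nrm_smul : ∀ (a : ℝ) (u : P → EReal), AEMeasurable u μ →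
    nrm (fun x => (a : EReal) * u x) = ENNReal.ofReal |a| * nrm u
  nrm_add_le : ∀ u v : P → EReal, AEMeasurable u μ → AEMeasurable v μ →
    nrm (fun x => u x + v x) ≤ (modulus : ℝ≥0∞) * (nrm u + nrm v)
  /-- the lattice property -/
  nrm_mono : ∀ u v : P → EReal, AEMeasurable u μ → AEMeasurable v μ →
    (∀ᵐ x ∂μ, (u x).abs ≤ (v x).abs) → nrm u ≤ nrm v
  /-- the Riesz--Fischer property (the sequence is indexed from `0`, whence the exponent) -/
  riesz_fischer : ∀ u : ℕ → P → ℝ≥0∞, (∀ n, AEMeasurable (u n) μ) →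
    nrm (fun x => ((∑' n, u n x : ℝ≥0∞) : EReal)) ≤
      ∑' n, (modulus : ℝ≥0∞) ^ (n + 1) * nrm (fun x => (u n x : EReal))
  /-- continuity of the quasinorm -/
  nrm_continuous : ∀ (u : ℕ → P → EReal) (v : P → EReal),
    (∀ n, AEMeasurable (u n) μ) → AEMeasurable v μ →
    Tendsto (fun n => nrm (fun x => u n x - v x)) atTop (𝓝 0) →
    Tendsto (fun n => nrm (u n)) atTop (𝓝 (nrm v))

/-- `γ : [0, l] → P` is a nonconstant rectifiable curve parametrized by arc length
(`l` is its length; only the values of `γ` on `[0, l]` matter). -/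
structure IsArcLengthCurve {P : Type*} [MetricSpace P] (γ : ℝ → P) (l : ℝ) : Prop where
  length_pos : 0 < l
  continuousOn : ContinuousOn γ (Icc 0 l)
  unitSpeed : HasUnitSpeedOn γ (Icc 0 l)

/-- The Borel function `g : P → [0,∞]` is an upper gradient of `u : P → [-∞,∞]`.
In `EReal`, `⊤ - ⊤ = ⊥ - ⊥ = ⊥`, so that `|(±∞) - (±∞)| = ∞`. -/
def IsUpperGradient {P : Type*} [MetricSpace P] (u : P → EReal) (g : P → ℝ≥0∞) : Prop :=
  Measurable[borel P] g ∧
    ∀ (γ : ℝ → P) (l : ℝ), IsArcLengthCurve γ l →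
      (u (γ 0) - u (γ l)).abs ≤ ∫⁻ s in Icc 0 l, g (γ s)

/-- The restriction of `u` to `S` is real-valued and continuous. -/
def IsRealContinuousOn {P : Type*} [MetricSpace P] (u : P → EReal) (S : Set P) : Prop :=
  (∀ x ∈ S, u x ≠ ⊤ ∧ u x ≠ ⊥) ∧ ContinuousOn u S

namespace QuasiBanachFunctionLattice

section Newtonian

variable {P : Type*} [MetricSpace P] [MeasurableSpace P] {μ : Measure P}
  (X : QuasiBanachFunctionLattice μ)

/-- Membership in the function lattice `X`. -/
def Mem (u : P → EReal) : Prop :=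
  AEMeasurable u μ ∧ X.nrm u < ∞

/-- The Newtonian quasinorm `‖u‖_X + inf_g ‖g‖_X`, over all upper gradients `g` of `u`. -/
noncomputable def newtonNrm (u : P → EReal) : ℝ≥0∞ :=
  X.nrm u + ⨅ (g : P → ℝ≥0∞) (_ : IsUpperGradient u g), X.nrm (fun x => (g x : EReal))

/-- Membership in the Newtonian space `N¹X`. -/
def MemNewton (u : P → EReal) : Prop :=
  X.Mem u ∧ X.newtonNrm u < ∞

/-- The Sobolev `X`-capacity. -/
noncomputable def cap (E : Set P) : ℝ≥0∞ :=
  ⨅ (u : P → EReal) (_ : X.MemNewton u ∧ ∀ x ∈ E, 1 ≤ u x), X.newtonNrm u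

/-- The capacity is `c`-quasiouter. -/
def IsQuasiouterWith (c : ℝ≥0) : Prop :=
  ∀ E : Set P, ⨅ (G : Set P) (_ : IsOpen G ∧ E ⊆ G), X.cap G ≤ (c : ℝ≥0∞) * X.cap E

/-- The capacity is quasiouter. -/
def IsQuasiouter : Prop :=
  ∃ c : ℝ≥0, 1 ≤ c ∧ X.IsQuasiouterWith c

/-- The capacity is outer. -/
def IsOuter : Prop :=
  X.IsQuasiouterWith 1

/-- The capacity is outer for sets of zero capacity. -/
def IsOuterForZero : Prop :=
  ∀ E : Set P, X.cap E = 0 → ∀ ε : ℝ≥0, 0 < ε →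
    ∃ G : Set P, IsOpen G ∧ E ⊆ G ∧ X.cap G < ε

/-- `u` is weakly quasicontinuous. -/
def IsWeaklyQuasicontinuous (u : P → EReal) : Prop :=
  ∀ ε : ℝ≥0, 0 < ε → ∃ E : Set P, X.cap E < ε ∧ IsRealContinuousOn u Eᶜ

/-- `u` is quasicontinuous. -/
def IsQuasicontinuous (u : P → EReal) : Prop :=
  ∀ ε : ℝ≥0, 0 < ε → ∃ G : Set P, IsOpen G ∧ X.cap G < ε ∧ IsRealContinuousOn u Gᶜ

/-- (A) Every Newtonian function is quasicontinuous. -/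
def PropA : Prop := ∀ u : P → EReal, X.MemNewton u → X.IsQuasicontinuous u

/-- (B) The capacity is outer. -/
def PropB : Prop := X.IsOuter

/-- (C) The capacity is quasiouter. -/
def PropC : Prop := X.IsQuasiouter

/-- (D) Every weakly quasicontinuous function is quasicontinuous. -/
def PropD : Prop := ∀ u : P → EReal, X.IsWeaklyQuasicontinuous u → X.IsQuasicontinuous u

/-- (E) The capacity is outer for sets of zero capacity. -/
def PropE : Prop := X.IsOuterForZero

/-- (F) Every Newtonian function has a quasicontinuous representative, equal to it
quasieverywhere. -/
def PropF : Prop := ∀ u : P → EReal, X.MemNewton u →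
  ∃ v : P → EReal, X.IsQuasicontinuous v ∧ X.cap {x | v x ≠ u x} = 0

/-- (G) Every Newtonian function is weakly quasicontinuous. -/
def PropG : Prop := ∀ u : P → EReal, X.MemNewton u → X.IsWeaklyQuasicontinuous u

end Newtonian

end QuasiBanachFunctionLattice

/-! The substantial implication is A ⇒ B (`PropA.propB`). Take a nearly optimal test function `f`
for `E`, with `0 ≤ f ≤ 1`, `f = 1` on `E` and upper gradient `g`. Since `f` is quasicontinuous,
there is an open `V` of small capacity such that `V ∪ {f > 1/(1+r)}` is an open set containing `E`.
If `v` is a test function for `V`, then `(1+r)f + v` is one for this open set, and continuity of the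
quasinorm (`tendsto_nrm_add`) makes the cost tend to that of `f`, with no loss of a factor `c_X`.

The other implications only move exceptional sets around: B ⇒ C is immediate, C ⇒ D enlarges them to
open sets, D ⇒ E tests on indicators of null sets, and F ⇒ G as well as (E and F) ⇒ A add the set
where `u` differs from its representative, using quasi-subadditivity (`cap_union_le`).

For the counterexamples, a countable space carries no nonconstant rectifiable curve, so `0` is an
upper gradient of every function. With the norm `sup a|u|` the capacity is `sup_E a`. On `{0} ∪
{2⁻ⁿ}` the weights used are: `a = 1` (B without A or G); `1` at `0` and `2` elsewhere (C without B);
`1` at `0` and `1/|x|` elsewhere (D without C); `0` at `0` and `1/|x|` elsewhere (F without E); `0`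
at `0` and `1` elsewhere (G without F). The last weight, transplanted to the rationals, makes
everything fail. -/

lemma EReal.abs_coe_ennreal (a : ℝ≥0∞) : (a : EReal).abs = a := by
  induction a using ENNReal.recTopCoe with
  | top => simp
  | coe a =>
    rw [show (((a : ℝ≥0) : ℝ≥0∞) : EReal) = ((a : ℝ) : EReal) from rfl, EReal.abs_def,
      NNReal.abs_eq, ENNReal.ofReal_coe_nnreal]

lemma EReal.abs_add_le (x y : EReal) : (x + y).abs ≤ x.abs + y.abs := by
  induction x <;> induction y <;> try simp
  rename_i a b
  rw [← EReal.coe_add, EReal.abs_def, EReal.abs_def, EReal.abs_def,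
    ← ENNReal.ofReal_add (abs_nonneg _) (abs_nonneg _)]
  exact ENNReal.ofReal_le_ofReal (_root_.abs_add_le a b)

lemma EReal.abs_le_abs_sub_add (x y : EReal) : x.abs ≤ (x - y).abs + y.abs := by
  induction x <;> induction y <;> try simp
  rename_i a b
  rw [← EReal.coe_sub, EReal.abs_def, EReal.abs_def, EReal.abs_def,
    ← ENNReal.ofReal_add (abs_nonneg _) (abs_nonneg _)]
  refine ENNReal.ofReal_le_ofReal ?_
  simpa using _root_.abs_add_le (a - b) b

lemma EReal.abs_sub_comm (x y : EReal) : (x - y).abs = (y - x).abs := by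
  induction x <;> induction y <;> try simp
  rename_i a b
  rw [← EReal.coe_sub, ← EReal.coe_sub, EReal.abs_def, EReal.abs_def, _root_.abs_sub_comm]

/-- Truncation to `[0,1]` is a contraction of the extended reals. -/
lemma EReal.abs_min_one_toENNReal_sub_le (x y : EReal) :
    (((min 1 x.toENNReal : ℝ≥0∞) : EReal) - (min 1 y.toENNReal : ℝ≥0∞)).abs ≤ (x - y).abs := by
  have key (r : ℝ) : ((min 1 (r : EReal).toENNReal : ℝ≥0∞) : EReal)
      = ((max (min 1 r) 0 : ℝ) : EReal) := by
    rw [EReal.toENNReal_of_ne_top (EReal.coe_ne_top r), EReal.toReal_coe,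
      ← ENNReal.ofReal_one, ← ENNReal.ofReal_min, EReal.coe_ennreal_ofReal]
  induction x <;> induction y
  case coe.coe a b =>
    rw [key, key, ← EReal.coe_sub, ← EReal.coe_sub, EReal.abs_def, EReal.abs_def]
    refine ENNReal.ofReal_le_ofReal ((abs_max_sub_max_le_abs _ _ _).trans ?_)
    simpa [max_self] using abs_min_sub_min_le_max 1 a 1 b
  -- If `x` or `y` is infinite, then so is `(x - y).abs`, because `⊤ - ⊤ = ⊥ - ⊥ = ⊥`.
  all_goals simp

lemma EReal.abs_coe_add_sub_coe_add_le (a b c d : ℝ≥0∞) :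
    (((a + b : ℝ≥0∞) : EReal) - (c + d : ℝ≥0∞)).abs ≤
      ((a : EReal) - c).abs + ((b : EReal) - d).abs := by
  induction a using ENNReal.recTopCoe <;> induction b using ENNReal.recTopCoe <;>
  induction c using ENNReal.recTopCoe <;> induction d using ENNReal.recTopCoe
  case coe.coe.coe.coe a b c d =>
    have key (r : ℝ≥0) : ((r : ℝ≥0∞) : EReal) = ((r : ℝ) : EReal) := rfl
    rw [← ENNReal.coe_add, ← ENNReal.coe_add]
    simp only [key, ← EReal.coe_sub, EReal.abs_def]
    rw [← ENNReal.ofReal_add (abs_nonneg _) (abs_nonneg _)]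
    refine ENNReal.ofReal_le_ofReal ?_
    push_cast
    rw [_root_.add_sub_add_comm]
    exact _root_.abs_add_le _ _
  all_goals simp

lemma EReal.abs_coe_mul_sub_coe_mul_le {r : ℝ≥0} (hr : r ≠ 0) (a b : ℝ≥0∞) :
    (((r * a : ℝ≥0∞) : EReal) - (r * b : ℝ≥0∞)).abs ≤ r * ((a : EReal) - b).abs := by
  induction a using ENNReal.recTopCoe <;> induction b using ENNReal.recTopCoe
  case coe.coe a b =>
    have key (r : ℝ≥0) : ((r : ℝ≥0∞) : EReal) = ((r : ℝ) : EReal) := rfl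
    rw [← ENNReal.coe_mul, ← ENNReal.coe_mul]
    simp only [key, ← EReal.coe_sub, EReal.abs_def]
    rw [NNReal.coe_mul, NNReal.coe_mul, ← mul_sub, _root_.abs_mul, NNReal.abs_eq,
      ENNReal.ofReal_mul r.coe_nonneg, ENNReal.ofReal_coe_nnreal]
  all_goals simp [hr]

/-! ### Operations on upper gradients -/

section UpperGradient

variable {P : Type*} [MetricSpace P]

lemma IsUpperGradient.aemeasurable [MeasurableSpace P] [OpensMeasurableSpace P] {μ : Measure P}
    {u : P → EReal} {g : P → ℝ≥0∞} (h : IsUpperGradient u g) : AEMeasurable g μ :=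
  (h.1.mono OpensMeasurableSpace.borel_le le_rfl).aemeasurable

lemma IsUpperGradient.min_one_toENNReal {u : P → EReal} {g : P → ℝ≥0∞} (h : IsUpperGradient u g) :
    IsUpperGradient (fun x => ((min 1 (u x).toENNReal : ℝ≥0∞) : EReal)) g :=
  ⟨h.1, fun γ l hγ => (EReal.abs_min_one_toENNReal_sub_le _ _).trans (h.2 γ l hγ)⟩

lemma IsUpperGradient.add {f₁ f₂ g₁ g₂ : P → ℝ≥0∞}
    (h₁ : IsUpperGradient (fun x => (f₁ x : EReal)) g₁)
    (h₂ : IsUpperGradient (fun x => (f₂ x : EReal)) g₂) :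
    IsUpperGradient (fun x => ((f₁ x + f₂ x : ℝ≥0∞) : EReal)) (fun x => g₁ x + g₂ x) :=
  ⟨h₁.1.add h₂.1, fun γ l hγ => (EReal.abs_coe_add_sub_coe_add_le _ _ _ _).trans <|
    (add_le_add (h₁.2 γ l hγ) (h₂.2 γ l hγ)).trans (le_lintegral_add _ _)⟩

lemma IsUpperGradient.const_mul {f g : P → ℝ≥0∞} {r : ℝ≥0} (hr : r ≠ 0)
    (h : IsUpperGradient (fun x => (f x : EReal)) g) :
    IsUpperGradient (fun x => ((r * f x : ℝ≥0∞) : EReal)) (fun x => r * g x) :=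
  ⟨h.1.const_mul _, fun γ l hγ => (EReal.abs_coe_mul_sub_coe_mul_le hr _ _).trans <|
    (mul_le_mul_right (h.2 γ l hγ) _).trans (lintegral_const_mul_le _ _)⟩

end UpperGradient

section Topology

variable {P : Type*} [MetricSpace P]

lemma IsRealContinuousOn.mono {u : P → EReal} {S T : Set P} (h : IsRealContinuousOn u S)
    (hT : T ⊆ S) : IsRealContinuousOn u T :=
  ⟨fun x hx => h.1 x (hT hx), h.2.mono hT⟩

lemma IsRealContinuousOn.congr {u v : P → EReal} {S : Set P} (h : IsRealContinuousOn u S)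
    (huv : EqOn v u S) : IsRealContinuousOn v S :=
  ⟨fun x hx => huv hx ▸ h.1 x hx, h.2.congr huv⟩

/-- Off `V` the preimage is the trace of an open set `O`; inside `V` the difference between the two
is absorbed by the union. -/
lemma IsOpen.union_preimage_of_continuousOn_compl {Y : Type*} [TopologicalSpace Y] {u : P → Y}
    {V : Set P} {W : Set Y} (hV : IsOpen V) (hu : ContinuousOn u Vᶜ) (hW : IsOpen W) :
    IsOpen (V ∪ u ⁻¹' W) := by
  obtain ⟨O, hO, h⟩ := continuousOn_iff'.1 hu W hW
  have : V ∪ u ⁻¹' W = V ∪ O := by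
    ext x
    have := Set.ext_iff.1 h x
    simp only [mem_inter_iff, mem_compl_iff] at this
    simp only [mem_union]
    tauto
  rw [this]
  exact hV.union hO

end Topology

namespace QuasiBanachFunctionLattice

/-! ### The quasinorm on nonnegative functions -/

section Lattice

variable {P : Type*} [MeasurableSpace P] {μ : Measure P} (X : QuasiBanachFunctionLattice μ)

lemma nrm_coe_add_le {f g : P → ℝ≥0∞} (hf : AEMeasurable f μ) (hg : AEMeasurable g μ) :
    X.nrm (fun x => ((f x + g x : ℝ≥0∞) : EReal)) ≤
      X.modulus * (X.nrm (fun x => (f x : EReal)) + X.nrm (fun x => (g x : EReal))) := by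
  simpa only [EReal.coe_ennreal_add] using
    X.nrm_add_le _ _ hf.coe_ereal_ennreal hg.coe_ereal_ennreal

lemma nrm_coe_mul (r : ℝ≥0) {f : P → ℝ≥0∞} (hf : AEMeasurable f μ) :
    X.nrm (fun x => ((r * f x : ℝ≥0∞) : EReal)) = r * X.nrm (fun x => (f x : EReal)) := by
  have := X.nrm_smul r _ hf.coe_ereal_ennreal
  rw [NNReal.abs_eq, ENNReal.ofReal_coe_nnreal] at this
  simp only [EReal.coe_ennreal_mul]
  exact this

lemma nrm_coe_mono {f g : P → ℝ≥0∞} (hf : AEMeasurable f μ) (hg : AEMeasurable g μ)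
    (h : ∀ᵐ x ∂μ, f x ≤ g x) : X.nrm (fun x => (f x : EReal)) ≤ X.nrm (fun x => (g x : EReal)) :=
  X.nrm_mono _ _ hf.coe_ereal_ennreal hg.coe_ereal_ennreal <| by
    simpa only [EReal.abs_coe_ennreal] using h

/-- A function in the lattice is finite almost everywhere. -/
lemma ae_ne_top {f : P → ℝ≥0∞} (hf : AEMeasurable f μ) (h : X.nrm (fun x => (f x : EReal)) ≠ ∞) :
    ∀ᵐ x ∂μ, f x ≠ ∞ := by
  classical
  set φ : ℝ≥0∞ → ℝ≥0∞ := fun t => if t = ∞ then ∞ else 0 with hφ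
  have hφm : Measurable φ :=
    Measurable.ite (measurableSet_singleton _) measurable_const measurable_const
  have hm : AEMeasurable (fun x => φ (f x)) μ := hφm.comp_aemeasurable hf
  have hle : X.nrm (fun x => (φ (f x) : EReal)) ≠ ∞ := by
    refine ne_top_of_le_ne_top h (X.nrm_coe_mono hm hf (Eventually.of_forall fun x => ?_))
    by_cases hx : f x = ∞ <;> simp [hφ, hx]
  -- The function equal to `∞` on `{f = ∞}` and `0` elsewhere is unchanged by doubling, so its
  -- finite norm must be zero.
  have h2 := X.nrm_coe_mul 2 hm
  have : (fun x => ((((2 : ℝ≥0) : ℝ≥0∞) * φ (f x) : ℝ≥0∞) : EReal))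
      = fun x => (φ (f x) : EReal) := by
    funext x
    by_cases hx : f x = ∞ <;> simp [hφ, hx]
  rw [this] at h2
  have h0 : X.nrm (fun x => (φ (f x) : EReal)) = 0 := by
    by_contra hne
    have := ENNReal.mul_left_inj hne hle |>.1 ((one_mul _).trans h2)
    norm_num at this
  filter_upwards [(X.nrm_eq_zero_iff _ hm.coe_ereal_ennreal).1 h0] with x hx hx'
  simp [hφ, hx'] at hx

/-- The quasinorm is continuous under small multiplicative and additive perturbations. -/
lemma tendsto_nrm_add {f : P → ℝ≥0∞} (hf : AEMeasurable f μ)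
    (hfin : X.nrm (fun x => (f x : EReal)) ≠ ∞) {r : ℕ → ℝ≥0} (hr : Tendsto r atTop (𝓝 0))
    {k : ℕ → P → ℝ≥0∞} (hk : ∀ n, AEMeasurable (k n) μ)
    (hk0 : Tendsto (fun n => X.nrm (fun x => (k n x : EReal))) atTop (𝓝 0)) :
    Tendsto (fun n => X.nrm (fun x => ((f x + (r n * f x + k n x) : ℝ≥0∞) : EReal))) atTop
      (𝓝 (X.nrm (fun x => (f x : EReal)))) := by
  have hm (n : ℕ) : AEMeasurable (fun x => r n * f x + k n x) μ := (hf.const_mul _).add (hk n)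
  refine X.nrm_continuous _ _ (fun n => (hf.add (hm n)).coe_ereal_ennreal) hf.coe_ereal_ennreal ?_
  have hlim : Tendsto (fun n => (X.modulus : ℝ≥0∞) * (r n * X.nrm (fun x => (f x : EReal))
      + X.nrm (fun x => (k n x : EReal)))) atTop (𝓝 0) := by
    have h1 : Tendsto (fun n => (r n : ℝ≥0∞) * X.nrm (fun x => (f x : EReal))) atTop
        (𝓝 (((0 : ℝ≥0) : ℝ≥0∞) * X.nrm (fun x => (f x : EReal)))) :=
      ENNReal.Tendsto.mul_const (ENNReal.tendsto_coe.2 hr) (Or.inr hfin)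
    have h2 := ENNReal.Tendsto.const_mul (a := (X.modulus : ℝ≥0∞)) (h1.add hk0)
      (Or.inr ENNReal.coe_ne_top)
    simpa using h2
  refine tendsto_of_tendsto_of_tendsto_of_le_of_le tendsto_const_nhds hlim
    (fun _ => zero_le) fun n => ?_
  calc X.nrm (fun x => ((f x + (r n * f x + k n x) : ℝ≥0∞) : EReal) - (f x : EReal))
      ≤ X.nrm (fun x => ((r n * f x + k n x : ℝ≥0∞) : EReal)) := by
        refine X.nrm_mono _ _ ?_ (hm n).coe_ereal_ennreal ?_
        · exact (hf.add (hm n)).coe_ereal_ennreal.sub hf.coe_ereal_ennreal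
        -- Cancelling `f x` requires it to be finite, since `⊤ - ⊤ = ⊥`; this holds almost
        -- everywhere.
        · filter_upwards [X.ae_ne_top hf hfin] with x hx
          lift f x to ℝ≥0 using hx with a
          rw [EReal.coe_ennreal_add, add_comm]
          refine le_of_eq (congrArg EReal.abs ?_)
          exact EReal.add_sub_cancel_right (b := (a : ℝ))
    _ ≤ X.modulus * (X.nrm (fun x => ((r n * f x : ℝ≥0∞) : EReal))
          + X.nrm (fun x => (k n x : EReal))) := X.nrm_coe_add_le (hf.const_mul _) (hk n)
    _ = _ := by rw [X.nrm_coe_mul _ hf]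

end Lattice

/-! ### Capacity and the implications between the properties -/

section Capacity

variable {P : Type*} [MetricSpace P] [MeasurableSpace P] {μ : Measure P}
  (X : QuasiBanachFunctionLattice μ)

lemma cap_mono {E F : Set P} (h : E ⊆ F) : X.cap E ≤ X.cap F :=
  le_iInf₂ fun u hu => iInf₂_le u ⟨hu.1, fun x hx => hu.2 x (h hx)⟩

lemma newtonNrm_le {u : P → EReal} {g : P → ℝ≥0∞} (hg : IsUpperGradient u g) :
    X.newtonNrm u ≤ X.nrm u + X.nrm (fun x => (g x : EReal)) :=
  add_le_add le_rfl (iInf₂_le g hg)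

lemma exists_isUpperGradient_of_newtonNrm_lt {u : P → EReal} {b : ℝ≥0∞} (h : X.newtonNrm u < b) :
    ∃ g, IsUpperGradient u g ∧ X.nrm u + X.nrm (fun x => (g x : EReal)) < b := by
  simp only [newtonNrm, ENNReal.add_iInf, iInf_lt_iff] at h
  obtain ⟨g, hg, h⟩ := h
  exact ⟨g, hg, h⟩

lemma memNewton_of_lt {u : P → EReal} {g : P → ℝ≥0∞} (hu : AEMeasurable u μ)
    (hg : IsUpperGradient u g) (h : X.nrm u + X.nrm (fun x => (g x : EReal)) < ∞) :
    X.MemNewton u :=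
  ⟨⟨hu, (le_self_add).trans_lt h⟩, (X.newtonNrm_le hg).trans_lt h⟩

lemma cap_le {E : Set P} {u : P → EReal} {g : P → ℝ≥0∞} (hu : AEMeasurable u μ)
    (hg : IsUpperGradient u g) (hE : ∀ x ∈ E, 1 ≤ u x) :
    X.cap E ≤ X.nrm u + X.nrm (fun x => (g x : EReal)) := by
  rcases eq_or_ne (X.nrm u + X.nrm (fun x => (g x : EReal))) ∞ with h | h
  · simp [h]
  · exact (iInf₂_le u ⟨X.memNewton_of_lt hu hg h.lt_top, hE⟩).trans (X.newtonNrm_le hg)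

/-- Test functions for the capacity may be taken with values in `[0,1]`. -/
lemma exists_of_cap_lt {E : Set P} {b : ℝ≥0∞} (h : X.cap E < b) :
    ∃ f g : P → ℝ≥0∞, AEMeasurable f μ ∧ (∀ x, f x ≤ 1) ∧ (∀ x ∈ E, f x = 1) ∧
      IsUpperGradient (fun x => (f x : EReal)) g ∧
      X.nrm (fun x => (f x : EReal)) + X.nrm (fun x => (g x : EReal)) < b := by
  simp only [cap, iInf_lt_iff] at h
  obtain ⟨u, ⟨hu, hE⟩, h⟩ := h
  obtain ⟨g, hg, h⟩ := X.exists_isUpperGradient_of_newtonNrm_lt h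
  have hm : AEMeasurable (fun x => min 1 (u x).toENNReal) μ :=
    aemeasurable_const.min hu.1.1.ereal_toENNReal
  refine ⟨fun x => min 1 (u x).toENNReal, g, hm, fun x => min_le_left _ _, fun x hx => ?_,
    hg.min_one_toENNReal, (add_le_add ?_ le_rfl).trans_lt h⟩
  · refine min_eq_left ?_
    have := EReal.toENNReal_le_toENNReal (hE x hx)
    rwa [← EReal.coe_ennreal_one, EReal.toENNReal_coe] at this
  · refine X.nrm_mono _ _ hm.coe_ereal_ennreal hu.1.1 (Eventually.of_forall fun x => ?_)
    rw [EReal.abs_coe_ennreal]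
    refine (min_le_right _ _).trans ?_
    induction u x with
    | bot => simp
    | top => simp
    | coe r =>
      rw [EReal.toENNReal_of_ne_top (EReal.coe_ne_top r), EReal.abs_def]
      exact ENNReal.ofReal_le_ofReal (le_abs_self _)

variable {X} in
lemma PropB.propC (hB : X.PropB) : X.PropC := ⟨1, le_rfl, hB⟩

variable {X} in
lemma PropC.propD (hC : X.PropC) : X.PropD := by
  obtain ⟨c, hc, hC⟩ := hC
  intro u hu ε hε
  have hc0 : 0 < c := zero_lt_one.trans_le hc
  obtain ⟨E, hE, huE⟩ := hu (ε / c) (by positivity)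
  have hlt : ⨅ (G : Set P) (_ : IsOpen G ∧ E ⊆ G), X.cap G < ε := by
    refine (hC E).trans_lt ?_
    have : (ε : ℝ≥0∞) = c * ((ε / c : ℝ≥0) : ℝ≥0∞) := by
      rw [← ENNReal.coe_mul, mul_div_cancel₀ _ hc0.ne']
    rw [this]
    exact ENNReal.mul_lt_mul_right (by exact_mod_cast hc0.ne') ENNReal.coe_ne_top hE
  simp only [iInf_lt_iff] at hlt
  obtain ⟨G, ⟨hG, hEG⟩, hlt⟩ := hlt
  exact ⟨G, hG, hlt, huE.mono (compl_subset_compl.2 hEG)⟩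

lemma cap_empty : X.cap ∅ = 0 := by
  have h0 : X.nrm 0 = 0 := (X.nrm_eq_zero_iff 0 aemeasurable_const).2 (ae_eq_refl _)
  have hg : IsUpperGradient (0 : P → EReal) (fun _ => 0) := ⟨measurable_const, by simp⟩
  refine le_antisymm ((X.cap_le aemeasurable_const hg (by simp)).trans ?_) zero_le
  simp only [EReal.coe_ennreal_zero]
  exact (add_eq_zero.2 ⟨h0, h0⟩).le

variable {X} in
lemma PropA.propF (hA : X.PropA) : X.PropF := fun u hu => ⟨u, hA u hu, by simp [X.cap_empty]⟩

variable [OpensMeasurableSpace P]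

/-- The sum of test functions for `E` and `F` is a test function for the union, and the sum of their
upper gradients is an upper gradient of it. -/
lemma cap_union_le (E F : Set P) : X.cap (E ∪ F) ≤ X.modulus * (X.cap E + X.cap F) := by
  have hc : (X.modulus : ℝ≥0∞) ≠ 0 := by
    have := X.one_le_modulus
    exact_mod_cast (zero_lt_one.trans_le this).ne'
  have key {a b : ℝ≥0∞} (ha : X.cap E < a) (hb : X.cap F < b) :
      X.cap (E ∪ F) ≤ X.modulus * (a + b) := by
    obtain ⟨f₁, g₁, hf₁, -, hE, hg₁, h₁⟩ := X.exists_of_cap_lt ha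
    obtain ⟨f₂, g₂, hf₂, -, hF, hg₂, h₂⟩ := X.exists_of_cap_lt hb
    have := X.cap_le (E := E ∪ F) (hf₁.add hf₂).coe_ereal_ennreal (hg₁.add hg₂) <| by
      intro x hx
      rw [← EReal.coe_ennreal_one, EReal.coe_ennreal_le_coe_ennreal_iff]
      rcases hx with hx | hx
      · simp [hE x hx]
      · simp [hF x hx]
    refine this.trans ((add_le_add (X.nrm_coe_add_le hf₁ hf₂)
      (X.nrm_coe_add_le hg₁.aemeasurable hg₂.aemeasurable)).trans ?_)
    rw [← mul_add, add_add_add_comm]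
    gcongr
  rw [mul_comm, ← ENNReal.div_le_iff_le_mul (Or.inl hc) (Or.inl ENNReal.coe_ne_top)]
  refine ENNReal.le_of_forall_pos_le_add fun ε hε hlt => ?_
  have hε' : ((ε / 2 : ℝ≥0) : ℝ≥0∞) ≠ 0 := by simpa using hε.ne'
  have hne := ENNReal.add_ne_top.1 hlt.ne
  rw [ENNReal.div_le_iff_le_mul (Or.inl hc) (Or.inl ENNReal.coe_ne_top), mul_comm]
  convert key (ENNReal.lt_add_right hne.1 hε') (ENNReal.lt_add_right hne.2 hε') using 2
  rw [add_add_add_comm, ← ENNReal.coe_add, add_halves]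

lemma exists_pos_cap_union_lt {ε : ℝ≥0} (hε : 0 < ε) :
    ∃ δ : ℝ≥0, 0 < δ ∧ ∀ E F : Set P, X.cap E < δ → X.cap F < δ → X.cap (E ∪ F) < ε := by
  have hc : 0 < X.modulus := zero_lt_one.trans_le X.one_le_modulus
  refine ⟨ε / (2 * X.modulus), by positivity, fun E F hE hF => ?_⟩
  refine (X.cap_union_le E F).trans_lt ?_
  have : ((ε : ℝ≥0∞)) = X.modulus * (((ε / (2 * X.modulus) : ℝ≥0) : ℝ≥0∞)
      + ((ε / (2 * X.modulus) : ℝ≥0) : ℝ≥0∞)) := by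
    norm_cast
    field_simp
    norm_num
  rw [this]
  exact ENNReal.mul_lt_mul_right (by exact_mod_cast hc.ne') ENNReal.coe_ne_top
    (ENNReal.add_lt_add hE hF)

variable {X}

lemma IsQuasicontinuous.isWeaklyQuasicontinuous_of_cap_ne_eq_zero {u v : P → EReal}
    (hv : X.IsQuasicontinuous v) (h : X.cap {x | v x ≠ u x} = 0) :
    X.IsWeaklyQuasicontinuous u := by
  intro ε hε
  obtain ⟨δ, hδ, hcap⟩ := X.exists_pos_cap_union_lt hε
  obtain ⟨G, -, hG, hvG⟩ := hv δ hδ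
  refine ⟨G ∪ {x | v x ≠ u x}, hcap _ _ hG (by simpa [h] using hδ), ?_⟩
  refine (hvG.mono (compl_subset_compl.2 subset_union_left)).congr fun x hx => ?_
  by_contra hne
  exact hx (Or.inr (Ne.symm hne))

lemma PropA.propB (hA : X.PropA) : X.PropB := by
  intro E
  rw [ENNReal.coe_one, one_mul]
  refine le_of_forall_gt fun b hb => ?_
  obtain ⟨f, g, hf, hf1, hfE, hg, hlt⟩ := X.exists_of_cap_lt hb
  have hfin : X.nrm (fun x => (f x : EReal)) + X.nrm (fun x => (g x : EReal)) < ∞ :=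
    hlt.trans_le le_top
  obtain ⟨hff, hgf⟩ := ENNReal.add_ne_top.1 hfin.ne
  have hqc := hA _ (X.memNewton_of_lt hf.coe_ereal_ennreal hg hfin)
  -- The same null sequence bounds the capacity of the open exceptional sets and sets the amount by
  -- which `f` is enlarged.
  set r : ℕ → ℝ≥0 := fun n => 1 / ((n : ℝ≥0) + 1) with hr
  have hr0 : ∀ n, 0 < r n := fun n => by positivity
  have hrlim : Tendsto r atTop (𝓝 0) := tendsto_one_div_add_atTop_nhds_zero_nat
  choose V hVo hVc hVu using fun n => hqc (r n) (hr0 n)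
  choose v h hvm hv1 hvV hh hvh using fun n => X.exists_of_cap_lt (hVc n)
  have hlim0 := ENNReal.tendsto_coe.2 hrlim
  have hv0 : Tendsto (fun n => X.nrm (fun x => (v n x : EReal))) atTop (𝓝 0) :=
    tendsto_of_tendsto_of_tendsto_of_le_of_le tendsto_const_nhds hlim0 (fun _ => zero_le)
      fun n => le_self_add.trans (hvh n).le
  have hh0 : Tendsto (fun n => X.nrm (fun x => (h n x : EReal))) atTop (𝓝 0) :=
    tendsto_of_tendsto_of_tendsto_of_le_of_le tendsto_const_nhds hlim0 (fun _ => zero_le)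
      fun n => le_add_self.trans (hvh n).le
  have hlim := (X.tendsto_nrm_add hf hff hrlim hvm hv0).add
    (X.tendsto_nrm_add hg.aemeasurable hgf hrlim (fun n => (hh n).aemeasurable) hh0)
  obtain ⟨n, hn⟩ := (hlim.eventually_lt_const hlt).exists
  -- This level is below `1`, so `E` lies in the preimage, yet high enough that `(1 + r n) f ≥ 1`
  -- there.
  set W : Set EReal := {t | ((((1 + r n)⁻¹ : ℝ≥0) : ℝ≥0∞) : EReal) < t}
  refine (iInf₂_le_of_le (V n ∪ (fun x => (f x : EReal)) ⁻¹' W) ⟨?_, ?_⟩ ?_).trans_lt hn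
  · refine X.cap_le ((hf.add ((hf.const_mul _).add (hvm n))).coe_ereal_ennreal)
      (hg.add ((hg.const_mul (hr0 n).ne').add (hh n))) ?_
    intro x hx
    rw [← EReal.coe_ennreal_one, EReal.coe_ennreal_le_coe_ennreal_iff]
    rcases hx with hx | hx
    · rw [hvV n x hx, ← add_assoc]
      exact le_add_self
    · simp only [W, mem_preimage, mem_ofPred_eq, EReal.coe_ennreal_lt_coe_ennreal_iff] at hx
      rw [← add_assoc]
      refine le_trans ?_ le_self_add
      calc (1 : ℝ≥0∞) = ((1 + r n : ℝ≥0) : ℝ≥0∞) * (((1 + r n)⁻¹ : ℝ≥0) : ℝ≥0∞) := by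
            rw [← ENNReal.coe_mul, mul_inv_cancel₀ (by positivity), ENNReal.coe_one]
        _ ≤ ((1 + r n : ℝ≥0) : ℝ≥0∞) * f x := by gcongr
        _ = f x + r n * f x := by rw [ENNReal.coe_add, add_mul, ENNReal.coe_one, one_mul]
  · exact (hVo n).union_preimage_of_continuousOn_compl (hVu n).2 isOpen_Ioi
  · intro x hx
    refine Or.inr ?_
    simp only [W, mem_preimage, mem_ofPred_eq, hfE x hx,
      EReal.coe_ennreal_lt_coe_ennreal_iff]
    rw [← ENNReal.coe_one, ENNReal.coe_lt_coe]
    exact inv_lt_one_of_one_lt₀ (lt_add_of_pos_right _ (hr0 n))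

lemma PropD.propE (hD : X.PropD) : X.PropE := by
  classical
  intro E hE ε hε
  set u : P → EReal := E.indicator 1 with hu
  -- Off the null set `E` the indicator is identically zero.
  have hw : X.IsWeaklyQuasicontinuous u := by
    intro δ hδ
    have : IsRealContinuousOn (0 : P → EReal) Eᶜ := ⟨by simp, continuousOn_const⟩
    exact ⟨E, by simpa [hE] using hδ, this.congr fun x hx => by simp [hu, show x ∉ E from hx]⟩
  obtain ⟨δ, hδ, hcap⟩ := X.exists_pos_cap_union_lt hε
  obtain ⟨G, hG, hGδ, huG⟩ := hD u hw δ hδ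
  have hpre : u ⁻¹' Ioi 0 = E := by
    ext x
    by_cases hx : x ∈ E <;> simp [hu, hx]
  refine ⟨G ∪ E, ?_, subset_union_right, hcap _ _ hGδ (by simpa [hE] using hδ)⟩
  rw [← hpre]
  exact hG.union_preimage_of_continuousOn_compl huG.2 isOpen_Ioi

lemma PropF.propG (hF : X.PropF) : X.PropG := fun u hu =>
  let ⟨_, hv, h⟩ := hF u hu
  hv.isWeaklyQuasicontinuous_of_cap_ne_eq_zero h

/-- The null set where `u` and its representative differ is covered by an open set of small
capacity, which keeps the whole exceptional set open. -/
lemma PropE.propA (hE : X.PropE) (hF : X.PropF) : X.PropA := by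
  intro u hu ε hε
  obtain ⟨v, hv, h⟩ := hF u hu
  obtain ⟨δ, hδ, hcap⟩ := X.exists_pos_cap_union_lt hε
  obtain ⟨G, hG, hGδ, hvG⟩ := hv δ hδ
  obtain ⟨H, hH, hsub, hHδ⟩ := hE _ h δ hδ
  refine ⟨G ∪ H, hG.union hH, hcap _ _ hGδ hHδ, ?_⟩
  refine (hvG.mono (compl_subset_compl.2 subset_union_left)).congr fun x hx => ?_
  by_contra hne
  exact hx (Or.inr (hsub (Ne.symm hne)))

end Capacity

end QuasiBanachFunctionLattice

/-! ### Curves and measures on countable spaces -/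

section CountableSpaces

/-- A connected subset of a countable metric space is at most a point, so `γ` is constant on `[0,
l]` and its length there is `0`, not `l > 0`. -/
lemma not_isArcLengthCurve_of_countable {P : Type*} [MetricSpace P] [Countable P] (γ : ℝ → P)
    (l : ℝ) : ¬ IsArcLengthCurve γ l := by
  intro h
  have hsub : (γ '' Icc 0 l).Subsingleton :=
    (to_countable (univ : Set P)).isTotallyDisconnected _ (subset_univ _)
      (isPreconnected_Icc.image _ h.continuousOn)
  have hl := h.length_pos
  have := h.unitSpeed (left_mem_Icc.2 hl.le) (right_mem_Icc.2 hl.le)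
  rw [inter_self, eVariationOn.constant_on hsub] at this
  simp only [NNReal.coe_one, sub_zero, one_mul] at this
  exact hl.not_ge (ENNReal.ofReal_eq_zero.1 this.symm)

/-- On a countable metric space there is a measure with finite mass, positive on balls, whose
null points are the points of a prescribed set with dense complement. -/
lemma exists_ballsPosFinite_of_dense_compl {P : Type*} [MetricSpace P] [Countable P]
    [MeasurableSpace P] [OpensMeasurableSpace P] {Z : Set P} (hZ : Dense Zᶜ) :
    ∃ μ : Measure P, BallsPosFinite μ ∧ ∀ x, μ {x} = 0 ↔ x ∈ Z := by
  classical
  obtain ⟨w, hw, hsum⟩ := ENNReal.exists_pos_sum_of_countable one_ne_zero P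
  set μ : Measure P :=
    Measure.sum fun x => (if x ∈ Z then (0 : ℝ≥0∞) else w x) • Measure.dirac x with hμ
  have hpt (x : P) : μ {x} = if x ∈ Z then (0 : ℝ≥0∞) else w x := by
    rw [hμ, Measure.sum_apply _ (measurableSet_singleton x), tsum_eq_single x]
    · by_cases hx : x ∈ Z <;> simp [hx]
    · intro y hy
      by_cases hyZ : y ∈ Z <;> simp [hy, hyZ]
  have hnull (x : P) : μ {x} = 0 ↔ x ∈ Z := by
    rw [hpt]
    by_cases hx : x ∈ Z <;> simp [hx, (hw x).ne']
  refine ⟨μ, fun x r hr => ⟨?_, ?_⟩, hnull⟩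
  · obtain ⟨y, hyZ, hy⟩ := hZ.exists_mem_open Metric.isOpen_ball ⟨x, Metric.mem_ball_self hr⟩
    exact (pos_iff_ne_zero.2 fun h => hyZ ((hnull y).1 h)).trans_le
      (measure_mono (singleton_subset_iff.2 hy))
  · refine (measure_mono (subset_univ _)).trans_lt ?_
    rw [hμ, Measure.sum_apply _ MeasurableSet.univ]
    refine (ENNReal.tsum_le_tsum fun y => ?_).trans_lt (hsum.trans ENNReal.one_lt_top)
    by_cases hy : y ∈ Z <;> simp [hy]

end CountableSpaces

/-- The weighted supremum lattice `‖u‖ = sup a|u|` on a countable space; the weight is required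
to vanish exactly at the null points. -/
noncomputable def QuasiBanachFunctionLattice.weightedSup {P : Type*} [Countable P]
    [MeasurableSpace P] {μ : Measure P} (a : P → ℝ≥0) (ha : ∀ x, μ {x} = 0 ↔ a x = 0) :
    QuasiBanachFunctionLattice μ where
  nrm u := ⨆ x, (a x : ℝ≥0∞) * (u x).abs
  modulus := 1
  one_le_modulus := le_rfl
  nrm_eq_zero_iff u _ := by
    rw [Filter.EventuallyEq, ae_iff_of_countable]
    simp only [ENNReal.iSup_eq_zero, mul_eq_zero, ENNReal.coe_eq_zero, EReal.abs_eq_zero_iff, ha,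
      Pi.zero_apply, ne_eq, or_iff_not_imp_left]
  nrm_smul r u _ := by
    rw [ENNReal.mul_iSup]
    refine iSup_congr fun x => ?_
    rw [EReal.abs_mul, EReal.abs_def, mul_left_comm]
  nrm_add_le u v _ _ := by
    rw [ENNReal.coe_one, one_mul]
    refine iSup_le fun x => ?_
    calc (a x : ℝ≥0∞) * (u x + v x).abs ≤ a x * ((u x).abs + (v x).abs) := by
          gcongr; exact EReal.abs_add_le _ _
      _ = a x * (u x).abs + a x * (v x).abs := mul_add _ _ _
      _ ≤ _ := add_le_add (le_iSup (fun x => (a x : ℝ≥0∞) * (u x).abs) x)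
        (le_iSup (fun x => (a x : ℝ≥0∞) * (v x).abs) x)
  nrm_mono u v _ _ h := by
    rw [ae_iff_of_countable] at h
    refine iSup_mono fun x => ?_
    by_cases hx : a x = 0
    · simp [hx]
    · gcongr
      exact h x (mt (ha x).1 hx)
  riesz_fischer u _ := by
    simp only [EReal.abs_coe_ennreal, ENNReal.coe_one, one_pow, one_mul]
    refine iSup_le fun x => ?_
    rw [← ENNReal.tsum_mul_left]
    exact ENNReal.tsum_le_tsum fun n => le_iSup (fun x => (a x : ℝ≥0∞) * u n x) x
  nrm_continuous u v _ _ h := by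
    have key (f g : P → EReal) : ⨆ x, (a x : ℝ≥0∞) * (f x).abs ≤
        (⨆ x, (a x : ℝ≥0∞) * (f x - g x).abs) + ⨆ x, (a x : ℝ≥0∞) * (g x).abs := by
      refine iSup_le fun x => ?_
      calc (a x : ℝ≥0∞) * (f x).abs ≤ a x * ((f x - g x).abs + (g x).abs) := by
            gcongr; exact EReal.abs_le_abs_sub_add _ _
        _ = a x * (f x - g x).abs + a x * (g x).abs := mul_add _ _ _
        _ ≤ _ := add_le_add (le_iSup (fun x => (a x : ℝ≥0∞) * (f x - g x).abs) x)
          (le_iSup (fun x => (a x : ℝ≥0∞) * (g x).abs) x)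
    have hup : Tendsto (fun n => (⨆ x, (a x : ℝ≥0∞) * (u n x - v x).abs)
        + ⨆ x, (a x : ℝ≥0∞) * (v x).abs) atTop (𝓝 (⨆ x, (a x : ℝ≥0∞) * (v x).abs)) := by
      simpa using h.add_const (⨆ x, (a x : ℝ≥0∞) * (v x).abs)
    have hlow : Tendsto (fun n => (⨆ x, (a x : ℝ≥0∞) * (v x).abs)
        - ⨆ x, (a x : ℝ≥0∞) * (u n x - v x).abs) atTop
        (𝓝 (⨆ x, (a x : ℝ≥0∞) * (v x).abs)) := by
      simpa using ENNReal.Tendsto.sub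
        (tendsto_const_nhds (x := ⨆ x, (a x : ℝ≥0∞) * (v x).abs)) h
        (Or.inr ENNReal.zero_ne_top)
    -- Both bounds are the triangle inequality `key`; the lower one uses it with `u n` and `v`
    -- exchanged.
    refine tendsto_of_tendsto_of_tendsto_of_le_of_le hlow hup (fun n => ?_) (fun n => key _ _)
    refine tsub_le_iff_left.2 ?_
    simpa only [EReal.abs_sub_comm (v _)] using key v (u n)

/-! ### Capacity for weighted supremum norms -/

namespace QuasiBanachFunctionLattice

section WeightedSup

variable {P : Type*} [MetricSpace P] [Countable P] [MeasurableSpace P] {μ : Measure P}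
  {a : P → ℝ≥0} (ha : ∀ x, μ {x} = 0 ↔ a x = 0)

omit [MetricSpace P] in
lemma weightedSup_nrm (u : P → EReal) :
    (weightedSup a ha).nrm u = ⨆ x, (a x : ℝ≥0∞) * (u x).abs := rfl

omit [MeasurableSpace P] in
lemma isUpperGradient_zero_of_countable (u : P → EReal) : IsUpperGradient u (fun _ => 0) :=
  ⟨measurable_const, fun γ l h => (not_isArcLengthCurve_of_countable γ l h).elim⟩

variable [OpensMeasurableSpace P]

lemma weightedSup_memNewton {u : P → EReal} (h : ⨆ x, (a x : ℝ≥0∞) * (u x).abs < ∞) :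
    (weightedSup a ha).MemNewton u := by
  refine (weightedSup a ha).memNewton_of_lt (measurable_of_countable u).aemeasurable
    (isUpperGradient_zero_of_countable u) ?_
  simpa [weightedSup_nrm] using h

/-- The indicator of `E`, with upper gradient `0`, is an optimal test function. -/
lemma weightedSup_cap (E : Set P) : (weightedSup a ha).cap E = ⨆ x ∈ E, (a x : ℝ≥0∞) := by
  classical
  apply le_antisymm
  · refine ((weightedSup a ha).cap_le (u := E.indicator 1)
      (measurable_of_countable _).aemeasurable (isUpperGradient_zero_of_countable _)
      fun x hx => by simp [hx]).trans ?_
    simp only [weightedSup_nrm, EReal.coe_ennreal_zero, EReal.abs_zero, mul_zero, ENNReal.iSup_zero,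
      add_zero]
    refine iSup_le fun x => ?_
    by_cases hx : x ∈ E
    · have h1 : (1 : EReal).abs = 1 := by simpa using EReal.abs_coe_ennreal 1
      simp only [hx, indicator_of_mem, Pi.one_apply, h1, mul_one]
      exact le_iSup₂ (f := fun x (_ : x ∈ E) => (a x : ℝ≥0∞)) x hx
    · simp [hx]
  · refine le_iInf₂ fun u hu => le_trans ?_ le_self_add
    refine iSup₂_le fun x hx => le_trans ?_ (le_iSup (fun x => (a x : ℝ≥0∞) * (u x).abs) x)
    refine le_mul_of_one_le_right zero_le ?_
    have := hu.2 x hx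
    induction h : u x with
    | bot => simp
    | top => simp
    | coe r =>
      rw [h] at this
      rw [EReal.abs_def, ← ENNReal.ofReal_one]
      exact ENNReal.ofReal_le_ofReal ((EReal.coe_le_coe_iff.1 this).trans (le_abs_self _))

lemma le_weightedSup_cap {E : Set P} {x : P} (hx : x ∈ E) :
    (a x : ℝ≥0∞) ≤ (weightedSup a ha).cap E := by
  rw [weightedSup_cap]
  exact le_iSup₂ (f := fun x (_ : x ∈ E) => (a x : ℝ≥0∞)) x hx

lemma weightedSup_cap_singleton (x : P) : (weightedSup a ha).cap {x} = a x := by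
  simp [weightedSup_cap]

lemma eq_empty_of_weightedSup_cap_lt {b : ℝ≥0∞} (h : ∀ x, b ≤ a x) {E : Set P}
    (hE : (weightedSup a ha).cap E < b) : E = ∅ :=
  eq_empty_of_forall_notMem fun x hx =>
    ((h x).trans (le_weightedSup_cap ha hx)).not_gt hE

end WeightedSup

end QuasiBanachFunctionLattice

/-- The convergent sequence `0, 1, 1/2, 1/4, …` as a subset of the line. -/
def halfPowers : Set ℝ := insert 0 (range fun n : ℕ => (1 / 2 : ℝ) ^ n)

/-! ### Topology of the convergent sequence -/

namespace halfPowers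

instance : Countable halfPowers := ((countable_range _).insert 0).to_subtype

/-- The limit point. -/
def limit : halfPowers := ⟨0, mem_insert _ _⟩

/-- The isolated points. -/
noncomputable def point (n : ℕ) : halfPowers := ⟨(1 / 2) ^ n, mem_insert_of_mem _ ⟨n, rfl⟩⟩

lemma eq_limit_or_point (x : halfPowers) : x = limit ∨ ∃ n, x = point n := by
  obtain ⟨x, rfl | ⟨n, rfl⟩⟩ := x
  · exact Or.inl rfl
  · exact Or.inr ⟨n, rfl⟩

lemma point_ne_limit (n : ℕ) : point n ≠ limit := fun h =>
  (pow_pos (by norm_num : (0 : ℝ) < 1 / 2) n).ne' (congrArg Subtype.val h)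

lemma point_injective : Function.Injective point := fun m n h =>
  (pow_right_strictAnti₀ (by norm_num : (0 : ℝ) < 1 / 2) (by norm_num)).injective
    (congrArg Subtype.val h)

lemma tendsto_point : Tendsto point atTop (𝓝 limit) :=
  tendsto_subtype_rng.2 <|
    tendsto_pow_atTop_nhds_zero_of_lt_one (by norm_num : (0 : ℝ) ≤ 1 / 2) (by norm_num)

lemma isOpen_singleton {x : halfPowers} (hx : x ≠ limit) : IsOpen {x} := by
  obtain ⟨n, rfl⟩ := (eq_limit_or_point x).resolve_left hx
  have hpos (n : ℕ) : (0 : ℝ) < (1 / 2) ^ n := by positivity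
  have hlt {m n : ℕ} (h : m < n) : 2 * (1 / 2 : ℝ) ^ n ≤ (1 / 2) ^ m := by
    have := pow_le_pow_of_le_one (by norm_num : (0 : ℝ) ≤ 1 / 2) (by norm_num)
      (Nat.succ_le_of_lt h)
    rw [pow_succ] at this
    linarith
  -- Other nonzero points differ from `2⁻ⁿ` by a factor of at least two, so this interval excludes
  -- them.
  have : ({point n} : Set halfPowers) =
      Subtype.val ⁻¹' Ioo (2 / 3 * (1 / 2 : ℝ) ^ n) (4 / 3 * (1 / 2) ^ n) := by
    ext y
    have := hpos n
    rcases eq_limit_or_point y with rfl | ⟨m, rfl⟩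
    · refine iff_of_false (point_ne_limit n).symm fun h => ?_
      have h1 : 2 / 3 * (1 / 2 : ℝ) ^ n < 0 := h.1
      linarith
    · rw [mem_singleton_iff, point_injective.eq_iff]
      simp only [mem_preimage, mem_Ioo, point]
      constructor
      · rintro rfl
        constructor <;> linarith
      · rintro ⟨h1, h2⟩
        have := hpos m
        rcases lt_trichotomy m n with h | h | h
        · linarith [hlt h]
        · exact h
        · linarith [hlt h]
  rw [this]
  exact isOpen_Ioo.preimage continuous_subtype_val

lemma dense_compl_limit : Dense ({limit}ᶜ : Set halfPowers) := fun x => by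
  by_cases hx : x = limit
  · rw [hx]
    exact mem_closure_of_tendsto tendsto_point (Eventually.of_forall fun n => point_ne_limit n)
  · exact subset_closure hx

lemma eventually_point_mem {G : Set halfPowers} (hG : IsOpen G) (h : limit ∈ G) :
    ∀ᶠ n in atTop, point n ∈ G := tendsto_point (hG.mem_nhds h)

lemma continuousOn_compl_limit {Y : Type*} [TopologicalSpace Y] (u : halfPowers → Y) :
    ContinuousOn u {limit}ᶜ := fun x hx => by
  refine ContinuousAt.continuousWithinAt ?_
  have : 𝓝 x = pure x := (isOpen_singleton_iff_nhds_eq_pure x).1 (isOpen_singleton hx)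
  rw [ContinuousAt, this]
  exact (tendsto_pure_pure u x).mono_right (pure_le_nhds _)

lemma continuous_of_continuousAt_limit {Y : Type*} [TopologicalSpace Y] {u : halfPowers → Y}
    (h : ContinuousAt u limit) : Continuous u := continuous_iff_continuousAt.2 fun x => by
  by_cases hx : x = limit
  · rwa [hx]
  · exact (continuousOn_compl_limit u).continuousAt
      (isOpen_compl_singleton.mem_nhds hx)

end halfPowers

/-! ### Weights realizing the counterexamples -/

namespace QuasiBanachFunctionLattice

open halfPowers

section

variable {P : Type*} [MetricSpace P] [Countable P] [MeasurableSpace P] [OpensMeasurableSpace P]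
  {μ : Measure P} {a : P → ℝ≥0} (ha : ∀ x, μ {x} = 0 ↔ a x = 0)

/-- The indicator of a point belongs to the Newtonian space over a countable space. -/
lemma weightedSup_memNewton_indicator {x : P} :
    (weightedSup a ha).MemNewton (({x} : Set P).indicator 1) := by
  classical
  refine weightedSup_memNewton ha (lt_of_le_of_lt (iSup_le fun y => ?_)
    (ENNReal.coe_lt_top (r := a x)))
  by_cases hy : y = x
  · have h1 : (1 : EReal).abs = 1 := by simpa using EReal.abs_coe_ennreal 1
    simp [hy, h1]
  · simp [hy]

/-- If the nonzero weights are at least one, and `x` is a non-null limit of other non-null points,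
then the indicator of `x` is not weakly quasicontinuous. -/
lemma not_isWeaklyQuasicontinuous_indicator {x : P} (hx : a x ≠ 0)
    (h1 : ∀ y, a y ≠ 0 → 1 ≤ a y) (hacc : x ∈ closure {y | y ≠ x ∧ a y ≠ 0}) :
    ¬ (weightedSup a ha).IsWeaklyQuasicontinuous (({x} : Set P).indicator 1) := by
  classical
  intro h
  obtain ⟨E, hE, hu⟩ := h 1 one_pos
  have hmem {y : P} (hy : a y ≠ 0) : y ∈ Eᶜ := fun hyE => by
    refine ((le_weightedSup_cap ha hyE).trans_lt hE).not_ge ?_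
    exact_mod_cast h1 y hy
  have hsub : {y | y ≠ x ∧ a y ≠ 0} ⊆ Eᶜ := fun y hy => hmem hy.2
  -- Every non-null point survives outside `E`, so `x` is a limit of points where the indicator is
  -- `0`, while its value at `x` is `1`.
  have hcont := ((hu.2 x (hmem hx)).mono hsub).mem_closure hacc
    (show MapsTo _ _ ({0} : Set EReal) from fun y hy => by simp [hy.1])
  simp at hcont

end

section

variable {μ : Measure halfPowers} {a : halfPowers → ℝ≥0} (ha : ∀ x, μ {x} = 0 ↔ a x = 0)

lemma weightedSup_propB_of_eq_one (h1 : ∀ x, a x = 1) : (weightedSup a ha).PropB := by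
  intro E
  rw [ENNReal.coe_one, one_mul]
  rcases E.eq_empty_or_nonempty with rfl | ⟨x, hx⟩
  · exact iInf₂_le ∅ ⟨isOpen_empty, le_rfl⟩
  · refine (iInf₂_le univ ⟨isOpen_univ, subset_univ _⟩).trans
      (le_trans ?_ (le_weightedSup_cap ha hx))
    simp [weightedSup_cap, h1]

lemma weightedSup_not_propG_of_eq_one (h1 : ∀ x, a x = 1) : ¬ (weightedSup a ha).PropG := fun h =>
  not_isWeaklyQuasicontinuous_indicator ha (x := limit) (by simp [h1]) (by simp [h1])
    (closure_mono (fun y hy => show y ≠ limit ∧ a y ≠ 0 from ⟨hy, by simp [h1]⟩)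
      (dense_compl_limit limit))
    (h _ (weightedSup_memNewton_indicator ha))

lemma weightedSup_propC_of_mem_Icc (h1 : ∀ x, 1 ≤ a x) {c : ℝ≥0} (hc : 1 ≤ c)
    (h2 : ∀ x, a x ≤ c) : (weightedSup a ha).PropC := by
  refine ⟨c, hc, fun E => ?_⟩
  rcases E.eq_empty_or_nonempty with rfl | ⟨x, hx⟩
  · refine (iInf₂_le ∅ ⟨isOpen_empty, le_rfl⟩).trans ?_
    simp [cap_empty]
  · refine (iInf₂_le univ ⟨isOpen_univ, subset_univ _⟩).trans ?_
    calc (weightedSup a ha).cap univ ≤ c := by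
          rw [weightedSup_cap]
          exact iSup₂_le fun y _ => by exact_mod_cast h2 y
      _ = c * 1 := (mul_one _).symm
      _ ≤ c * (weightedSup a ha).cap E := by
          gcongr
          refine le_trans ?_ (le_weightedSup_cap ha hx)
          exact_mod_cast h1 x

/-- If the weight is frequently at least `b` near the limit point, then so is the capacity of its
neighbourhoods. -/
lemma le_iInf_cap_of_frequently {b : ℝ≥0∞} (hb : ∃ᶠ n in atTop, b ≤ a (point n)) :
    b ≤ ⨅ (G : Set halfPowers) (_ : IsOpen G ∧ {limit} ⊆ G), (weightedSup a ha).cap G := by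
  refine le_iInf₂ fun G hG => ?_
  obtain ⟨n, hn, hnG⟩ :=
    (hb.and_eventually (eventually_point_mem hG.1 (singleton_subset_iff.1 hG.2))).exists
  exact hn.trans (le_weightedSup_cap ha hnG)

lemma weightedSup_not_isQuasiouterWith {c : ℝ≥0} {b : ℝ≥0}
    (hb : ∃ᶠ n in atTop, b ≤ a (point n)) (hlt : c * a limit < b) :
    ¬ (weightedSup a ha).IsQuasiouterWith c := by
  intro h
  have := (le_iInf_cap_of_frequently ha (b := b) (by exact_mod_cast hb)).trans (h {limit})
  rw [weightedSup_cap_singleton] at this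
  exact hlt.not_ge (by exact_mod_cast this)

lemma weightedSup_not_propE (h0 : a limit = 0) (h1 : ∀ n, 1 ≤ a (point n)) :
    ¬ (weightedSup a ha).PropE := by
  intro h
  obtain ⟨G, hG, hsub, hlt⟩ := h {limit} (by simp [weightedSup_cap_singleton, h0]) 1 one_pos
  refine hlt.not_ge ((le_iInf_cap_of_frequently ha (b := 1)
    (Frequently.of_forall fun n => by exact_mod_cast h1 n)).trans (iInf₂_le G ⟨hG, hsub⟩))

/-- A set of capacity below `1` is empty, so weakly quasicontinuous functions are continuous
everywhere. -/
lemma weightedSup_propD_of_one_le {P : Type*} [MetricSpace P] [Countable P] [MeasurableSpace P]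
    [OpensMeasurableSpace P] {μ : Measure P} {a : P → ℝ≥0} (ha : ∀ x, μ {x} = 0 ↔ a x = 0)
    (h1 : ∀ x, 1 ≤ a x) : (weightedSup a ha).PropD := by
  intro u hu ε hε
  obtain ⟨E, hE, hc⟩ := hu 1 one_pos
  have := eq_empty_of_weightedSup_cap_lt ha (b := 1) (fun x => by exact_mod_cast h1 x)
    (by simpa using hE)
  rw [this] at hc
  exact ⟨∅, isOpen_empty, by simpa [cap_empty] using hε, hc⟩

/-- A function in the lattice takes finite values where the weight is positive. -/
lemma ne_top_ne_bot_of_memNewton {u : halfPowers → EReal} (hu : (weightedSup a ha).MemNewton u)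
    {x : halfPowers} (hx : a x ≠ 0) : u x ≠ ⊤ ∧ u x ≠ ⊥ := by
  have h := (le_iSup (fun x => (a x : ℝ≥0∞) * (u x).abs) x).trans_lt hu.1.2
  constructor <;> rintro h' <;> simp [h', hx] at h

lemma weightedSup_propG_of_limit_eq_zero (h0 : a limit = 0) (h1 : ∀ x, x ≠ limit → a x ≠ 0) :
    (weightedSup a ha).PropG := fun _ hu _ hε =>
  ⟨{limit}, by simpa [weightedSup_cap_singleton, h0] using hε,
    fun _ hx => ne_top_ne_bot_of_memNewton ha hu (h1 _ hx), continuousOn_compl_limit _⟩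

lemma weightedSup_not_propF_of_eq_one (h0 : a limit = 0) (h1 : ∀ x, x ≠ limit → a x = 1) :
    ¬ (weightedSup a ha).PropF := by
  classical
  intro hF
  -- This function alternates between `1` and `0` along the sequence. A representative must agree
  -- with it at every isolated point, so no value at the limit makes it continuous.
  set u : halfPowers → EReal := (range fun n => point (2 * n)).indicator 1 with hu
  have hmem : (weightedSup a ha).MemNewton u := by
    refine weightedSup_memNewton ha (lt_of_le_of_lt (iSup_le fun y => ?_) ENNReal.one_lt_top)
    have h1' : (1 : EReal).abs = 1 := by simpa using EReal.abs_coe_ennreal 1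
    have ha1 : (a y : ℝ≥0∞) ≤ 1 := by
      by_cases hy : y = limit
      · simp [hy, h0]
      · simp [h1 y hy]
    by_cases hy : y ∈ range fun n => point (2 * n)
    · rw [hu, indicator_of_mem hy, Pi.one_apply, h1', mul_one]
      exact ha1
    · rw [hu, indicator_of_notMem hy, EReal.abs_zero, mul_zero]
      exact zero_le
  obtain ⟨v, hv, hvu⟩ := hF u hmem
  have heq (n : ℕ) : v (point n) = u (point n) := by
    by_contra hne
    have := le_weightedSup_cap ha (E := {x | v x ≠ u x}) (x := point n) hne
    rw [hvu, h1 _ (point_ne_limit n)] at this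
    simp at this
  obtain ⟨G, hG, hlt, hc⟩ := hv 1 one_pos
  have hGp (n : ℕ) : point n ∉ G := fun hn => by
    have := (le_weightedSup_cap ha hn).trans_lt hlt
    simp [h1 _ (point_ne_limit n)] at this
  have hGl : limit ∉ G := fun hl => by
    obtain ⟨n, hn⟩ := (eventually_point_mem hG hl).exists
    exact hGp n hn
  have hlim : Tendsto (fun n => v (point n)) atTop (𝓝 (v limit)) :=
    (hc.2 limit hGl).tendsto.comp
      (tendsto_nhdsWithin_iff.2 ⟨tendsto_point, Eventually.of_forall hGp⟩)
  have h_even (n : ℕ) : v (point (2 * n)) = 1 := by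
    rw [heq, hu, indicator_of_mem (mem_range_self n), Pi.one_apply]
  have h_odd (n : ℕ) : v (point (2 * n + 1)) = 0 := by
    rw [heq, hu, indicator_of_notMem]
    rintro ⟨m, hm⟩
    have := point_injective hm
    omega
  have he : Tendsto (fun n : ℕ => 2 * n) atTop atTop :=
    tendsto_id.const_mul_atTop' two_pos
  have l1 := hlim.comp he
  have l0 := hlim.comp (tendsto_atTop_mono (fun n => Nat.le_succ (2 * n)) he)
  simp only [Function.comp_def, h_even, Nat.succ_eq_add_one, h_odd] at l1 l0
  have := (tendsto_nhds_unique l1 tendsto_const_nhds).symm.trans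
    (tendsto_nhds_unique l0 tendsto_const_nhds)
  simp at this

/-- A finite norm `M` means `|u x| ≤ M|x|` off the limit point, so resetting `u` to `0` there, on a
null set, gives a continuous function. The weight at the limit is `0⁻¹ = 0`. -/
lemma weightedSup_propF_of_eq_inv (h : ∀ x, a x = ‖(x : ℝ)‖₊⁻¹) : (weightedSup a ha).PropF := by
  classical
  intro u hu
  have h0 : a limit = 0 := by simp [h, limit]
  have hpos {x : halfPowers} (hx : x ≠ limit) : (x : ℝ) ≠ 0 := fun h => hx (Subtype.ext h)
  have hne {x : halfPowers} (hx : x ≠ limit) : a x ≠ 0 := by simpa [h] using hpos hx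
  obtain ⟨M, hM⟩ := ENNReal.lt_iff_exists_coe.1 hu.1.2
  set w : halfPowers → ℝ := fun x => if x = limit then 0 else (u x).toReal with hw
  have hw0 : w limit = 0 := if_pos rfl
  have hwu {x : halfPowers} (hx : x ≠ limit) : (w x : EReal) = u x := by
    have := ne_top_ne_bot_of_memNewton ha hu (hne hx)
    simp only [hw, hx, if_false]
    exact EReal.coe_toReal this.1 this.2
  have hbound (x : halfPowers) : ‖w x‖ ≤ M * ‖(x : ℝ)‖ := by
    by_cases hx : x = limit
    · rw [hx, hw0, norm_zero]
      positivity
    · have hle : (a x : ℝ≥0∞) * (u x).abs ≤ M :=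
        (le_iSup (fun x => (a x : ℝ≥0∞) * (u x).abs) x).trans_eq hM.1
      rw [← hwu hx, EReal.abs_def, ← Real.norm_eq_abs, ofReal_norm, enorm_eq_nnnorm,
        ← ENNReal.coe_mul, ENNReal.coe_le_coe, h, inv_mul_le_iff₀ (by simpa using hpos hx),
        mul_comm] at hle
      exact_mod_cast hle
  have hcont : Continuous w := by
    refine continuous_of_continuousAt_limit ?_
    rw [ContinuousAt, hw0]
    refine squeeze_zero_norm hbound ?_
    have : Continuous fun x : halfPowers => (M : ℝ) * ‖(x : ℝ)‖ := by fun_prop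
    simpa [limit] using this.tendsto limit
  refine ⟨fun x => (w x : EReal), fun ε hε => ⟨∅, isOpen_empty, by simpa [cap_empty] using hε,
    fun x _ => ⟨EReal.coe_ne_top _, EReal.coe_ne_bot _⟩,
    (continuous_coe_real_ereal.comp hcont).continuousOn⟩, ?_⟩
  refine le_antisymm (((weightedSup a ha).cap_mono (F := {limit}) fun x hx => ?_).trans_eq ?_)
    zero_le
  · by_contra hx'
    exact hx (hwu hx')
  · rw [weightedSup_cap_singleton, h0, ENNReal.coe_zero]

end

/-- Suitable measures on the sequence space exist for each weight positive off the limit point. -/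
lemma exists_measure_halfPowers (a : halfPowers → ℝ≥0) (h : ∀ x, x ≠ limit → a x ≠ 0) :
    ∃ μ : Measure halfPowers, BallsPosFinite μ ∧ ∀ x, μ {x} = 0 ↔ a x = 0 :=
  exists_ballsPosFinite_of_dense_compl (Z := {x | a x = 0})
    (dense_compl_limit.mono fun x hx => h x hx)

/-- On the rationals, with weight vanishing at the origin only, both (E) and (G) fail. -/
lemma weightedSup_rat_not_propE_not_propG {μ : Measure ℚ} {a : ℚ → ℝ≥0}
    (ha : ∀ x, μ {x} = 0 ↔ a x = 0) (h0 : a 0 = 0) (h1 : ∀ x, x ≠ 0 → a x = 1) :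
    ¬ (weightedSup a ha).PropE ∧ ¬ (weightedSup a ha).PropG := by
  constructor
  · intro h
    obtain ⟨G, hG, hsub, hlt⟩ := h {0} (by simp [weightedSup_cap_singleton, h0]) 1 one_pos
    obtain ⟨y, hy0, hyG⟩ := (dense_compl_singleton (0 : ℚ)).exists_mem_open hG
      ⟨0, singleton_subset_iff.1 hsub⟩
    have := (le_weightedSup_cap ha hyG).trans_lt hlt
    simp [h1 y hy0] at this
  · intro h
    -- Unlike in the sequence space, a non-null point such as `1` is here a limit of other non-null
    -- points.
    refine not_isWeaklyQuasicontinuous_indicator ha (x := 1) (by simp [h1])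
      (fun y hy => ?_) ?_ (h _ (weightedSup_memNewton_indicator ha))
    · by_cases hy0 : y = 0
      · exact absurd (hy0 ▸ h0) hy
      · exact (h1 y hy0).ge
    · have hd : Dense ({1, 0}ᶜ : Set ℚ) := Rat.dense_compl_compact (Set.toFinite {1, 0}).isCompact
      refine closure_mono (fun y hy => ?_) (hd 1)
      simp only [mem_compl_iff, mem_insert_iff, mem_singleton_iff, not_or] at hy
      exact ⟨hy.1, by simp [h1 y hy.2]⟩

end QuasiBanachFunctionLattice

theorem theorem1p2 :
    (∀ (P : Type*) [MetricSpace P] [MeasurableSpace P] [OpensMeasurableSpace P]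
      (μ : Measure P) (_ : BallsPosFinite μ) (X : QuasiBanachFunctionLattice μ),
      ((X.PropD ∧ X.PropG ↔ X.PropE ∧ X.PropF) ∧ (X.PropE ∧ X.PropF ↔ X.PropA)) ∧
      (X.PropA → X.PropB) ∧ (X.PropB → X.PropC) ∧ (X.PropC → X.PropD) ∧
      (X.PropD → X.PropE) ∧ (X.PropA → X.PropF) ∧ (X.PropF → X.PropG)) ∧
    (∃ (P : Type) (_ : MetricSpace P) (_ : MeasurableSpace P) (_ : BorelSpace P)
      (μ : Measure P) (_ : BallsPosFinite μ) (X : QuasiBanachFunctionLattice μ),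
      X.PropB ∧ ¬ X.PropA) ∧
    (∃ (P : Type) (_ : MetricSpace P) (_ : MeasurableSpace P) (_ : BorelSpace P)
      (μ : Measure P) (_ : BallsPosFinite μ) (X : QuasiBanachFunctionLattice μ),
      X.PropC ∧ ¬ X.PropB) ∧
    (∃ (P : Type) (_ : MetricSpace P) (_ : MeasurableSpace P) (_ : BorelSpace P)
      (μ : Measure P) (_ : BallsPosFinite μ) (X : QuasiBanachFunctionLattice μ),
      X.PropD ∧ ¬ X.PropC) ∧
    (∃ (P : Type) (_ : MetricSpace P) (_ : MeasurableSpace P) (_ : BorelSpace P)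
      (μ : Measure P) (_ : BallsPosFinite μ) (X : QuasiBanachFunctionLattice μ),
      X.PropB ∧ ¬ X.PropG) ∧
    (∃ (P : Type) (_ : MetricSpace P) (_ : MeasurableSpace P) (_ : BorelSpace P)
      (μ : Measure P) (_ : BallsPosFinite μ) (X : QuasiBanachFunctionLattice μ),
      X.PropF ∧ ¬ X.PropE) ∧
    (∃ (P : Type) (_ : MetricSpace P) (_ : MeasurableSpace P) (_ : BorelSpace P)
      (μ : Measure P) (_ : BallsPosFinite μ) (X : QuasiBanachFunctionLattice μ),
      X.PropG ∧ ¬ X.PropF) ∧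
    (∃ (P : Type) (_ : MetricSpace P) (_ : MeasurableSpace P) (_ : BorelSpace P)
      (μ : Measure P) (_ : BallsPosFinite μ) (X : QuasiBanachFunctionLattice μ),
      ¬ X.PropA ∧ ¬ X.PropB ∧ ¬ X.PropC ∧ ¬ X.PropD ∧ ¬ X.PropE ∧ ¬ X.PropF ∧ ¬ X.PropG) := by
  classical
  open QuasiBanachFunctionLattice halfPowers in
  refine ⟨fun P _ _ _ μ _ X => ?_, ?_, ?_, ?_, ?_, ?_, ?_, ?_⟩
  · have hAE : X.PropA → X.PropE := fun h => h.propB.propC.propD.propE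
    have hEF : X.PropE ∧ X.PropF ↔ X.PropA :=
      ⟨fun h => h.1.propA h.2, fun h => ⟨hAE h, h.propF⟩⟩
    have hDG : X.PropD ∧ X.PropG ↔ X.PropA :=
      ⟨fun h u hu => h.1 u (h.2 u hu), fun h => ⟨h.propB.propC.propD, h.propF.propG⟩⟩
    exact ⟨⟨hDG.trans hEF.symm, hEF⟩,
      PropA.propB, PropB.propC, PropC.propD, PropD.propE, PropA.propF, PropF.propG⟩
  · obtain ⟨μ, hμ, ha⟩ := exists_measure_halfPowers (fun _ => 1) (by simp)
    exact ⟨halfPowers, inferInstance, inferInstance, inferInstance, μ, hμ, weightedSup _ ha,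
      weightedSup_propB_of_eq_one ha fun _ => rfl, fun h =>
        weightedSup_not_propG_of_eq_one ha (fun _ => rfl) h.propF.propG⟩
  · obtain ⟨μ, hμ, ha⟩ := exists_measure_halfPowers (fun x => if x = limit then 1 else 2)
      (by simp +contextual)
    refine ⟨halfPowers, inferInstance, inferInstance, inferInstance, μ, hμ, weightedSup _ ha,
      weightedSup_propC_of_mem_Icc ha (fun x => ?_) one_le_two (fun x => ?_),
      weightedSup_not_isQuasiouterWith ha (b := 2) (Frequently.of_forall fun n => ?_) ?_⟩
    · split_ifs <;> norm_num
    · split_ifs <;> norm_num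
    · simp [point_ne_limit]
    · simp
  · obtain ⟨μ, hμ, ha⟩ := exists_measure_halfPowers
      (fun x => if x = limit then 1 else ‖(x : ℝ)‖₊⁻¹) fun x hx => by
        simpa [hx] using show (x : ℝ) ≠ 0 from fun h => hx (Subtype.ext h)
    have hval (n : ℕ) : ‖((point n : halfPowers) : ℝ)‖₊⁻¹ = 2 ^ n := by
      simp [point]
    refine ⟨halfPowers, inferInstance, inferInstance, inferInstance, μ, hμ, weightedSup _ ha,
      weightedSup_propD_of_one_le ha fun x => ?_, ?_⟩
    · rcases eq_limit_or_point x with rfl | ⟨n, rfl⟩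
      · simp
      · rw [if_neg (point_ne_limit n), hval]
        exact one_le_pow₀ one_le_two
    · rintro ⟨c, -, h⟩
      -- The limit point has capacity `1`, while the weights `2 ^ n` eventually exceed `c + 1`.
      refine weightedSup_not_isQuasiouterWith ha (c := c) (b := c + 1) ?_ (by simp) h
      refine Eventually.frequently ?_
      simp only [point_ne_limit, if_false, hval]
      exact (tendsto_pow_atTop_atTop_of_one_lt one_lt_two).eventually_ge_atTop _
  · obtain ⟨μ, hμ, ha⟩ := exists_measure_halfPowers (fun _ => 1) (by simp)
    exact ⟨halfPowers, inferInstance, inferInstance, inferInstance, μ, hμ, weightedSup _ ha,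
      weightedSup_propB_of_eq_one ha fun _ => rfl,
      weightedSup_not_propG_of_eq_one ha fun _ => rfl⟩
  · obtain ⟨μ, hμ, ha⟩ := exists_measure_halfPowers (fun x => ‖(x : ℝ)‖₊⁻¹) fun x hx => by
      simpa using show (x : ℝ) ≠ 0 from fun h => hx (Subtype.ext h)
    refine ⟨halfPowers, inferInstance, inferInstance, inferInstance, μ, hμ, weightedSup _ ha,
      weightedSup_propF_of_eq_inv ha fun _ => rfl,
      weightedSup_not_propE ha (by simp [limit]) fun n => ?_⟩
    simpa [point] using one_le_pow₀ (M₀ := ℝ≥0) (n := n) one_le_two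
  · obtain ⟨μ, hμ, ha⟩ := exists_measure_halfPowers (fun x => if x = limit then 0 else 1)
      (by simp +contextual)
    exact ⟨halfPowers, inferInstance, inferInstance, inferInstance, μ, hμ, weightedSup _ ha,
      weightedSup_propG_of_limit_eq_zero ha (by simp) (by simp +contextual),
      weightedSup_not_propF_of_eq_one ha (by simp) (by simp +contextual)⟩
  · obtain ⟨μ, hμ, ha⟩ := exists_ballsPosFinite_of_dense_compl (dense_compl_singleton (0 : ℚ))
    have ha' : ∀ x, μ {x} = 0 ↔ (fun x : ℚ => if x = 0 then (0 : ℝ≥0) else 1) x = 0 := by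
      simpa using ha
    obtain ⟨hE, hG⟩ := weightedSup_rat_not_propE_not_propG ha' (by simp) (by simp +contextual)
    exact ⟨ℚ, inferInstance, inferInstance, inferInstance, μ, hμ, weightedSup _ ha',
      fun h => hE h.propB.propC.propD.propE, fun h => hE h.propC.propD.propE,
      fun h => hE h.propD.propE, fun h => hE h.propE, hE, fun h => hG h.propG, hG⟩
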